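/- Links are unoriented links in $S^3$, given by plane link diagrams up to Reidemeister moves. An $H(2)$-move is the local change of link diagrams that replaces, inside a disk, a pair of parallel arcs $)($ by the pair $\asymp$ (and leaves the diagram unchanged outside the disk). The $H(2)$-unknotting number $u_2(L)$ of a link $L$ is the minimal number of $H(2)$-moves needed to change $L$ into the unknot. For integers $a_1,\dots,a_n$ let $C(a_1,\dots,a_n)$ be the 2-bridge link in Conway normal form whose continued fraction is $\frac pq=a_1+\cfrac{1}{a_2+\cdots+\cfrac{1}{a_n}}$. **Corollary 1.2.** The 2-bridge knots $$9_{21}=C(3,1,1,2,2),\quad 9_{23}=C(2,2,1,2,2),\quad 9_{26}=C(3,1,1,1,1,2),\quad 9_{31}=C(2,1,1,1,1,1,2)$$ of Rolfsen's table, and likewise their mirror images, have $H(2)$-unknotting number one: $u_2(9_{21})=u_2(9_{23})=u_2(9_{26})=u_2(9_{31})=1$. -/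

import Mathlib

/-!
Unoriented links are represented by *sliced link diagrams*, that is, plane link diagrams in general
position with respect to the height function, cut by horizontal lines into slices each of which
contains exactly one maximum, one minimum or one crossing.  Links are sliced diagrams up to the
Reidemeister moves (and plane isotopy, which for sliced diagrams has its own list of local moves).
Words are read from bottom to top.
-/

namespace KnotDiagram

/-- The elementary pieces of a sliced diagram: a local minimum `cup` (the shape `∪`), a local
maximum `cap` (the shape `∩`), and a crossing.  In `cross true` the strand that runs from bottom
left to top right is the over-strand; in `cross false` it is the under-strand. -/
inductive Piece : Type
  | cup : Piece
  | cap : Piece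
  | cross : Bool → Piece
  deriving DecidableEq

namespace Piece

/-- The number of end points at the bottom of a piece. -/
def inn : Piece → ℕ
  | cup => 0
  | cap => 2
  | cross _ => 2

/-- The number of end points at the top of a piece. -/
def out : Piece → ℕ
  | cup => 2
  | cap => 0
  | cross _ => 2

/-- Exchange over and under. -/
def mirror : Piece → Piece
  | cup => cup
  | cap => cap
  | cross e => cross (!e)

end Piece

/-- A horizontal slice: one elementary piece with exactly `pos` vertical strands to its left, and
any number of vertical strands to its right.  Strands are numbered `0, 1, 2, …` from the left. -/
structure Slice : Type where
  piece : Piece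
  pos : ℕ
  deriving DecidableEq

/-- Exchange over and under. -/
def Slice.mirror (s : Slice) : Slice := ⟨s.piece.mirror, s.pos⟩

/-- The slice in which a minimum creates the strands `i` and `i + 1`. -/
abbrev cup (i : ℕ) : Slice := ⟨Piece.cup, i⟩

/-- The slice in which a maximum joins the strands `i` and `i + 1`. -/
abbrev cap (i : ℕ) : Slice := ⟨Piece.cap, i⟩

/-- The slice in which the strands `i` and `i + 1` cross. -/
abbrev cross (e : Bool) (i : ℕ) : Slice := ⟨Piece.cross e, i⟩

/-- `strands n w` is the number of strands above the stack of slices `w` if there are `n` strands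
below it; it is `none` if some slice does not fit on the number of strands it is put on. -/
def strands : ℕ → List Slice → Option ℕ
  | n, [] => some n
  | n, s :: w =>
      if s.pos + s.piece.inn ≤ n then strands (n - s.piece.inn + s.piece.out) w else none

/-- A (sliced, unoriented) link diagram: a stack of slices, listed from bottom to top, that fit on
each other and have no strands at the bottom and at the top. -/
structure Diagram : Type where
  word : List Slice
  closed : strands 0 word = some 0

/-- The local moves that generate equivalence of links: plane isotopies (`exchange`, `zigzag`,
`swing`) and the three Reidemeister moves.  A `swing` pulls a strand over or under an extremum;
the strand then meets the other leg of the extremum, so the sign of the crossing *as a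
slice* changes although over and under do not. -/
inductive LocalMove : List Slice → List Slice → Prop
  | exchange (g h : Piece) (i k : ℕ) :
      LocalMove [⟨g, i⟩, ⟨h, i + g.out + k⟩] [⟨h, i + g.inn + k⟩, ⟨g, i⟩]
  | zigzag_left (i : ℕ) : LocalMove [cup i, cap (i + 1)] []
  | zigzag_right (i : ℕ) : LocalMove [cup (i + 1), cap i] []
  | swing_cup (e : Bool) (i : ℕ) :
      LocalMove [cup i, cross e (i + 1)] [cup (i + 1), cross (!e) i]
  | swing_cap (e : Bool) (i : ℕ) :
      LocalMove [cross e (i + 1), cap i] [cross (!e) i, cap (i + 1)]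
  | reidemeister1_cup (e : Bool) (i : ℕ) : LocalMove [cup i, cross e i] [cup i]
  | reidemeister1_cap (e : Bool) (i : ℕ) : LocalMove [cross e i, cap i] [cap i]
  | reidemeister2 (e : Bool) (i : ℕ) : LocalMove [cross e i, cross (!e) i] []
  | reidemeister3 (e : Bool) (i : ℕ) :
      LocalMove [cross e i, cross e (i + 1), cross e i]
        [cross e (i + 1), cross e i, cross e (i + 1)]

/-- `D'` arises from `D` by one of the local moves, applied somewhere in the diagram. -/
def Diagram.Move (D D' : Diagram) : Prop :=
  ∃ a l r b, LocalMove l r ∧ D.word = a ++ l ++ b ∧ D'.word = a ++ r ++ b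

/-- The smoothing change `)(` ⟶ `≍` of two neighbouring strands `i` and `i + 1`,
applied somewhere in the diagram. -/
def Diagram.Smoothing (D D' : Diagram) : Prop :=
  ∃ a b i, D.word = a ++ b ∧ D'.word = a ++ [cap i, cup i] ++ b

/-- The mirror image of a diagram: all crossings are switched. -/
def Diagram.mirror (D : Diagram) : Diagram where
  word := D.word.map Slice.mirror
  closed := by
    have key : ∀ (w : List Slice) (n : ℕ), strands n (w.map Slice.mirror) = strands n w := by
      intro w
      induction w with
      | nil => intro n; rfl
      | cons s w ih =>
        intro n
        obtain ⟨p, i⟩ := s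
        cases p <;> simp only [List.map_cons, strands, ih] <;> rfl
    rw [key]
    exact D.closed

/-- Unoriented links: diagrams up to the equivalence relation generated by the local moves. -/
def Link : Type := Quot Diagram.Move

/-- The link presented by a diagram. -/
def Diagram.link (D : Diagram) : Link := Quot.mk Diagram.Move D

/-- The unknot, presented by a circle without crossings. -/
def unknot : Link := Diagram.link ⟨[cup 0, cap 0], by decide⟩

/-- `L'` arises from `L` by one H(2)-move, that is, `L` and `L'` have diagrams which are equal
except in a disk, where one is `)(` and the other one is `≍`. -/
def Link.H2Move (L L' : Link) : Prop :=
  ∃ D D' : Diagram, D.link = L ∧ D'.link = L' ∧ (D.Smoothing D' ∨ D'.Smoothing D)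

/-- `L` can be changed into the unknot by `k` H(2)-moves. -/
def Link.UnknotsIn : ℕ → Link → Prop
  | 0, L => L = unknot
  | k + 1, L => ∃ L', L.H2Move L' ∧ L'.UnknotsIn k

/-- The H(2)-unknotting number: the minimal number of H(2)-moves needed to change `L` into the
unknot. -/
noncomputable def Link.u₂ (L : Link) : ℕ∞ := ⨅ (k : ℕ) (_ : L.UnknotsIn k), (k : ℕ∞)

/-- The row of `|a|` crossings between the strands `i` and `i + 1`, of type `e` for
`a > 0` and of the opposite type for `a < 0`. -/
def twists (e : Bool) (i : ℕ) (a : ℤ) : List Slice :=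
  List.replicate a.natAbs (cross (if 0 ≤ a then e else !e) i)

/-- The alternating rows of twists of the Conway normal form and the arcs that close it at the top.
The rows lie between the strands `1, 2` if `middle = true`, between the strands `0, 1` if
`middle = false`, and crossings of these two positions have opposite types as slices, so that
the diagram is alternating when all coefficients are positive.  After a row between the
strands `1, 2` the strands are joined as `0, 1` and `2, 3`; after a row between the strands
`0, 1` they are joined as `1, 2` and `0, 3`. -/
def conwayRows : (middle : Bool) → List ℤ → List Slice
  | true, [] => [cap 1, cap 0]
  | false, [] => [cap 0, cap 0]
  | true, a :: as => twists true 1 a ++ conwayRows false as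
  | false, a :: as => twists false 0 a ++ conwayRows true as

/-- The Conway normal form `C(a₁, …, aₙ)` of a two-bridge link, with continued fraction
`p / q = a₁ + 1 / (a₂ + ⋯ + 1 / aₙ)`. -/
def conway (as : List ℤ) : Diagram where
  word := [cup 0, cup 2] ++ conwayRows true as
  closed := by
    have twist : ∀ (m : ℕ) (e : Bool) (i : ℕ) (w : List Slice), i + 2 ≤ 4 →
        strands 4 (List.replicate m (cross e i) ++ w) = strands 4 w := by
      intro m e i w hi
      induction m with
      | zero => rfl
      | succ m ih => simp [List.replicate_succ, strands, Piece.inn, Piece.out, hi, ih]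
    have key : ∀ (l : List ℤ) (b : Bool), strands 4 (conwayRows b l) = some 0 := by
      intro l
      induction l with
      | nil => intro b; cases b <;> decide
      | cons a l ih =>
        intro b
        cases b <;> simp [conwayRows, twists, twist, ih]
    simpa [strands, Piece.inn, Piece.out] using key as true

/-! The four knots of Rolfsen's table, by their Conway notations there (`31122`, `22122`,
`311112`, `2111112`); the continued fractions are `43/12`, `45/19`, `47/13` and `55/21`. -/

/-- The knot `9₂₁`. -/
def knot9_21 : Diagram := conway [3, 1, 1, 2, 2]

/-- The knot `9₂₃`. -/
def knot9_23 : Diagram := conway [2, 2, 1, 2, 2]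

/-- The knot `9₂₆`. -/
def knot9_26 : Diagram := conway [3, 1, 1, 1, 1, 2]

/-- The knot `9₃₁`. -/
def knot9_31 : Diagram := conway [2, 1, 1, 1, 1, 1, 2]

end KnotDiagram

/-! The value 1 needs two facts for each knot: it is nontrivial, and one smoothing unknots it.
Nontriviality comes from dihedral colourings: at a crossing the under-arc's colour `y` becomes `2x -
y`, with `x` the colour of the over-arc. Whether some colouring has colours generating the additive
group `A` is a link invariant (`sameColorings_of_localMove`). The colours of a crossingless circle
generate a cyclic group, so it has no such colouring for `ZMod p × ZMod p`, `p ≠ 1`. The two-bridge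
diagram `p / q` has one: give its two minima the colours `(1, 0)` and `(0, 1)`.

The other half is a certificate checked by computation. Each knot gets an explicit diagram, a place
to smooth, and two lists of simplifying moves: one leads back to the Conway diagram, the other leads
from the smoothed diagram to the circle. `isotopic_simplify` makes such lists sound. Mirror images
follow because mirroring preserves every move. -/

namespace KnotDiagram

/-! ### Dihedral colourings and their invariance -/

section Colorings

variable {A : Type*} [CommRing A]

/-- The condition that a piece at position `i` imposes on the colours `f` of the strands below it
in a dihedral colouring. -/
def Piece.Admissible (f : ℕ → A) (i : ℕ) : Piece → Prop
  | .cup => True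
  | .cap => f i = f (i + 1)
  | .cross _ => True

instance Piece.decidableAdmissible [DecidableEq A] (f : ℕ → A) (i : ℕ) :
    ∀ g : Piece, Decidable (g.Admissible f i)
  | .cup => isTrue trivial
  | .cap => inferInstanceAs (Decidable (f i = f (i + 1)))
  | .cross _ => isTrue trivial

/-- The colours of the strands above a piece at position `i`, given the colours `f` below it and,
if the piece is a minimum, the colour `c` of its arc. -/
def Piece.recolor (c : A) (f : ℕ → A) (i : ℕ) : Piece → ℕ → A
  | .cup => fun k => if k < i then f k else if k < i + 2 then c else f (k - 2)
  | .cap => fun k => if k < i then f k else f (k + 2)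
  | .cross true => fun k =>
      if k = i then 2 * f i - f (i + 1) else if k = i + 1 then f i else f k
  | .cross false => fun k =>
      if k = i then f (i + 1) else if k = i + 1 then 2 * f (i + 1) - f i else f k

/-- The subgroup generated by `S` and the colour `c` of the arc of a minimum. -/
def Piece.enlarge (c : A) (S : AddSubgroup A) : Piece → AddSubgroup A
  | .cup => S ⊔ AddSubgroup.zmultiples c
  | .cap => S
  | .cross _ => S

/-- The stack `w` has a dihedral colouring which extends the colours `f` at the bottom and
whose colours, together with `S`, generate `A`.  Beyond the strands that are present, `f` is padded
by zeros. -/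
def Colorable : List Slice → (ℕ → A) → AddSubgroup A → Prop
  | [], _, S => S = ⊤
  | s :: w, f, S => ∃ c, s.piece.Admissible f s.pos ∧
      Colorable w (s.piece.recolor c f s.pos) (s.piece.enlarge c S)

/-- New colours are integer combinations of old ones and `c`. This maintains the hypothesis of
`SameColorings` through a stack, and is why only the colours of minima enlarge the subgroup. -/
theorem Piece.recolor_mem {f : ℕ → A} {S : AddSubgroup A} (hf : ∀ k, f k ∈ S) (c : A) (i : ℕ)
    (g : Piece) (k : ℕ) : g.recolor c f i k ∈ g.enlarge c S := by
  have two (x y : ℕ) : 2 * f x - f y ∈ S := by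
    rw [two_mul]
    exact S.sub_mem (S.add_mem (hf x) (hf x)) (hf y)
  rcases g with _ | _ | _ | _ <;> simp only [recolor, enlarge] <;> split_ifs <;>
    first
    | exact hf _
    | exact two _ _
    | exact AddSubgroup.mem_sup_left (hf _)
    | exact AddSubgroup.mem_sup_right (AddSubgroup.mem_zmultiples c)

theorem Piece.enlarge_comm (g h : Piece) (c d : A) (S : AddSubgroup A) :
    h.enlarge d (g.enlarge c S) = g.enlarge c (h.enlarge d S) := by
  cases g <;> cases h <;> simp only [enlarge]
  exact sup_right_comm _ _ _

theorem sup_zmultiples_of_mem {S : AddSubgroup A} {c : A} (hc : c ∈ S) :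
    S ⊔ AddSubgroup.zmultiples c = S :=
  sup_eq_left.mpr (AddSubgroup.zmultiples_le_of_mem hc)

/-- The reflection `c ↦ 2 * x - c` is an involution, so one inclusion gives both. -/
theorem sup_zmultiples_two_mul_sub {S : AddSubgroup A} {x : A} (hx : x ∈ S) (c : A) :
    S ⊔ AddSubgroup.zmultiples (2 * x - c) = S ⊔ AddSubgroup.zmultiples c := by
  have key (d : A) : S ⊔ AddSubgroup.zmultiples (2 * x - d) ≤ S ⊔ AddSubgroup.zmultiples d := by
    refine sup_le le_sup_left (AddSubgroup.zmultiples_le_of_mem ?_)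
    rw [two_mul]
    exact AddSubgroup.sub_mem _ (AddSubgroup.mem_sup_left (S.add_mem hx hx))
      (AddSubgroup.mem_sup_right (AddSubgroup.mem_zmultiples d))
  refine le_antisymm (key c) ?_
  simpa using key (2 * x - c)

theorem Piece.admissible_recolor_right (g h : Piece) (i k : ℕ) (c : A) (f : ℕ → A) :
    h.Admissible (g.recolor c f i) (i + g.out + k) ↔ h.Admissible f (i + g.inn + k) := by
  rcases g with _ | _ | _ | _ <;> rcases h with _ | _ | _ | _ <;>
    simp [Admissible, recolor, inn, out] <;> grind

theorem Piece.admissible_recolor_left (g h : Piece) (i k : ℕ) (c : A) (f : ℕ → A) :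
    g.Admissible (h.recolor c f (i + g.inn + k)) i ↔ g.Admissible f i := by
  rcases g with _ | _ | _ | _ <;> rcases h with _ | _ | _ | _ <;>
    simp [Admissible, recolor, inn] <;> grind

theorem Piece.recolor_comm (g h : Piece) (i k : ℕ) (c d : A) (f : ℕ → A) :
    h.recolor d (g.recolor c f i) (i + g.out + k) =
      g.recolor c (h.recolor d f (i + g.inn + k)) i := by
  funext x
  rcases g with _ | _ | _ | _ <;> rcases h with _ | _ | _ | _ <;>
    simp only [recolor, inn, out] <;> grind

/-- Two stacks are interchangeable in colourings. -/
def SameColorings (A : Type*) [CommRing A] (l r : List Slice) : Prop :=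
  ∀ (w : List Slice) (f : ℕ → A) (S : AddSubgroup A), (∀ k, f k ∈ S) →
    (Colorable (l ++ w) f S ↔ Colorable (r ++ w) f S)

/-- A prefix only changes the colours and the subgroup, over which the relation already quantifies.
-/
theorem SameColorings.append_left {l r : List Slice} (h : SameColorings A l r) (a : List Slice) :
    SameColorings A (a ++ l) (a ++ r) := by
  induction a with
  | nil => exact h
  | cons s a ih =>
    intro w f S hf
    exact exists_congr fun c => and_congr_right fun _ =>
      ih w _ _ (s.piece.recolor_mem hf c s.pos)

theorem sameColorings_exchange (g h : Piece) (i k : ℕ) :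
    SameColorings A [⟨g, i⟩, ⟨h, i + g.out + k⟩] [⟨h, i + g.inn + k⟩, ⟨g, i⟩] := by
  intro w f S _
  simp only [List.cons_append, List.nil_append, Colorable, Piece.admissible_recolor_right,
    Piece.admissible_recolor_left, Piece.recolor_comm]
  constructor
  · rintro ⟨c, hc, d, hd, H⟩
    exact ⟨d, hd, c, hc, by rwa [Piece.enlarge_comm]⟩
  · rintro ⟨d, hd, c, hc, H⟩
    exact ⟨c, hc, d, hd, by rwa [Piece.enlarge_comm]⟩

theorem Colorable.congr {w : List Slice} {f g : ℕ → A} {S T : AddSubgroup A}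
    (h : Colorable w f S) (hf : ∀ k, f k = g k) (hS : S = T) : Colorable w g T := by
  rwa [← funext hf, ← hS]

theorem sameColorings_of_localMove {l r : List Slice} (h : LocalMove l r) :
    SameColorings A l r := by
  induction h with
  | exchange g h i k => exact sameColorings_exchange g h i k
  | zigzag_left i =>
    intro w f S hf
    simp only [List.cons_append, List.nil_append, Colorable, Piece.Admissible, Piece.enlarge,
      Piece.recolor]
    constructor
    · rintro ⟨c, -, d, h, H⟩
      -- The new arc belongs to the strand passing through, so its colour adds no generator.
      have hc : c = f i := by grind
      exact H.congr (fun k => by grind) (sup_zmultiples_of_mem (hc ▸ hf i))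
    -- The witness for the maximum is a dummy: only minima read it. The same holds for crossings.
    · intro H
      exact ⟨f i, trivial, 0, by grind,
        H.congr (fun k => by grind) (sup_zmultiples_of_mem (hf i)).symm⟩
  | zigzag_right i =>
    intro w f S hf
    simp only [List.cons_append, List.nil_append, Colorable, Piece.Admissible, Piece.enlarge,
      Piece.recolor]
    constructor
    · rintro ⟨c, -, d, h, H⟩
      have hc : c = f i := by grind
      exact H.congr (fun k => by grind) (sup_zmultiples_of_mem (hc ▸ hf i))
    · intro H
      exact ⟨f i, trivial, 0, by grind,
        H.congr (fun k => by grind) (sup_zmultiples_of_mem (hf i)).symm⟩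
  | swing_cup e i =>
    intro w f S hf
    cases e <;>
    simp only [List.cons_append, List.nil_append, Colorable, Piece.Admissible, Piece.enlarge,
      Piece.recolor, Bool.not_true, Bool.not_false]
    · constructor <;>
      -- The extremum passes under the strand coloured `f i`, so its colour is reflected in `f i`;
      -- the reflection serves both directions.
      · rintro ⟨c, -, d, h, H⟩
        exact ⟨2 * f i - c, trivial, 0, trivial,
          H.congr (fun k => by grind) (sup_zmultiples_two_mul_sub (hf i) c).symm⟩
    · constructor <;>
      · rintro ⟨c, -, d, h, H⟩
        exact ⟨c, trivial, 0, trivial, H.congr (fun k => by grind) rfl⟩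
  | swing_cap e i =>
    intro w f S hf
    cases e <;>
    simp only [List.cons_append, List.nil_append, Colorable, Piece.Admissible, Piece.enlarge,
      Piece.recolor, Bool.not_true, Bool.not_false] <;>
    · constructor <;>
      · rintro ⟨c, -, d, h, H⟩
        exact ⟨0, trivial, 0, by grind, H.congr (fun k => by grind) rfl⟩
  | reidemeister1_cup e i =>
    intro w f S hf
    cases e <;>
    simp only [List.cons_append, List.nil_append, Colorable, Piece.Admissible, Piece.enlarge,
      Piece.recolor] <;>
    · constructor
      · rintro ⟨c, -, d, h, H⟩
        exact ⟨c, trivial, H.congr (fun k => by grind) rfl⟩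
      · rintro ⟨c, -, H⟩
        exact ⟨c, trivial, 0, trivial, H.congr (fun k => by grind) rfl⟩
  | reidemeister1_cap e i =>
    intro w f S hf
    cases e <;>
    simp only [List.cons_append, List.nil_append, Colorable, Piece.Admissible, Piece.enlarge,
      Piece.recolor] <;>
    · constructor
      · rintro ⟨c, -, d, h, H⟩
        exact ⟨0, by grind, H.congr (fun k => by grind) rfl⟩
      · rintro ⟨c, h, H⟩
        exact ⟨0, trivial, 0, by grind, H.congr (fun k => by grind) rfl⟩
  | reidemeister2 e i =>
    intro w f S hf
    cases e <;>
    simp only [List.cons_append, List.nil_append, Colorable, Piece.Admissible, Piece.enlarge,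
      Piece.recolor, Bool.not_true, Bool.not_false] <;>
    · constructor
      · rintro ⟨c, -, d, -, H⟩
        exact H.congr (fun k => by grind) rfl
      · intro H
        exact ⟨0, trivial, 0, trivial, H.congr (fun k => by grind) rfl⟩
  | reidemeister3 e i =>
    intro w f S hf
    cases e <;>
    simp only [List.cons_append, List.nil_append, Colorable, Piece.Admissible, Piece.enlarge,
      Piece.recolor] <;>
    · constructor <;>
      · rintro ⟨c, -, d, -, a, -, H⟩
        exact ⟨0, trivial, 0, trivial, 0, trivial, H.congr (fun k => by grind) rfl⟩

/-- The link has a dihedral colouring whose colours generate the group `A`. -/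
def Link.GeneratesColoring (A : Type*) [CommRing A] : Link → Prop :=
  Quot.lift (fun D => Colorable D.word (0 : ℕ → A) ⊥) (by
    rintro D D' ⟨a, l, r, b, h, hD, hD'⟩
    rw [hD, hD']
    exact propext ((sameColorings_of_localMove h).append_left a b 0 ⊥ fun _ => zero_mem _))

end Colorings

/-! ### Nontriviality of the four knots -/

theorem not_generatesColoring_unknot (R : Type*) [CommRing R] [Nontrivial R] :
    ¬ unknot.GeneratesColoring (R × R) := by
  rintro ⟨c, -, d, -, h⟩
  simp only [Piece.enlarge, bot_sup_eq, Colorable] at h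
  have key (x : R × R) : ∃ n : ℤ, n • c = x :=
    AddSubgroup.mem_zmultiples_iff.mp (h ▸ AddSubgroup.mem_top x)
  obtain ⟨m, hm⟩ := key (1, 0)
  obtain ⟨n, hn⟩ := key (0, 1)
  simp only [Prod.ext_iff, zsmul_eq_mul, Prod.fst_mul, Prod.snd_mul, Prod.fst_intCast,
    Prod.snd_intCast] at hm hn
  refine one_ne_zero (α := R) ?_
  -- With `m • c = (1, 0)` and `n • c = (0, 1)`, the determinant of these two multiples of `c` is
  -- both 1 and 0.
  linear_combination (-n * c.2) * hm.1 + n * c.1 * hm.2 - hn.2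

/-- The colours of the two minima already generate everything, so only the conditions at the closing
maxima remain to be checked. -/
theorem generatesColoring_conway {p : ℕ} {as : List ℤ}
    (h : Colorable (conwayRows true as)
      (fun k => if k < 2 then (1, 0) else if k < 4 then (0, 1) else 0 : ℕ → ZMod p × ZMod p) ⊤) :
    (conway as).link.GeneratesColoring (ZMod p × ZMod p) := by
  refine ⟨(1, 0), trivial, (0, 1), trivial, h.congr (fun k => ?_) ?_⟩
  · simp only [Piece.recolor, Pi.zero_apply]
    grind
  · symm
    simp only [Piece.enlarge, bot_sup_eq, eq_top_iff]
    rintro ⟨x, y⟩ -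
    obtain ⟨m, rfl⟩ := ZMod.intCast_surjective x
    obtain ⟨n, rfl⟩ := ZMod.intCast_surjective y
    exact AddSubgroup.mem_sup.mpr ⟨m • (1, 0), ⟨m, rfl⟩, n • (0, 1), ⟨n, rfl⟩, by simp⟩

theorem Link.ne_unknot_of_generatesColoring {p : ℕ} (hp : p ≠ 1) {L : Link}
    (h : L.GeneratesColoring (ZMod p × ZMod p)) : L ≠ unknot := by
  have : Nontrivial (ZMod p) := ZMod.nontrivial_iff.mpr hp
  rintro rfl
  exact not_generatesColoring_unknot _ h

theorem knot9_21_link_ne_unknot : knot9_21.link ≠ unknot := by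
  -- The modulus is the numerator of the continued fraction, the determinant of the knot.
  refine Link.ne_unknot_of_generatesColoring (p := 43) (by decide) (generatesColoring_conway ?_)
  -- Nine crossings impose no condition; the two maxima are then checked in `ZMod 43`.
  iterate 9 refine ⟨0, trivial, ?_⟩
  refine ⟨0, ?_, 0, ?_, rfl⟩ <;> decide +kernel

theorem knot9_23_link_ne_unknot : knot9_23.link ≠ unknot := by
  refine Link.ne_unknot_of_generatesColoring (p := 45) (by decide) (generatesColoring_conway ?_)
  iterate 9 refine ⟨0, trivial, ?_⟩
  refine ⟨0, ?_, 0, ?_, rfl⟩ <;> decide +kernel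

theorem knot9_26_link_ne_unknot : knot9_26.link ≠ unknot := by
  refine Link.ne_unknot_of_generatesColoring (p := 47) (by decide) (generatesColoring_conway ?_)
  iterate 9 refine ⟨0, trivial, ?_⟩
  refine ⟨0, ?_, 0, ?_, rfl⟩ <;> decide +kernel

theorem knot9_31_link_ne_unknot : knot9_31.link ≠ unknot := by
  refine Link.ne_unknot_of_generatesColoring (p := 55) (by decide) (generatesColoring_conway ?_)
  iterate 9 refine ⟨0, trivial, ?_⟩
  refine ⟨0, ?_, 0, ?_, rfl⟩ <;> decide +kernel

/-! ### Isotopies of stacks of slices -/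

/-- A stack of slices may be replaced by another one in every diagram, without changing the link. -/
def Isotopic (l r : List Slice) : Prop :=
  ∀ (a b : List Slice) (h : strands 0 (a ++ l ++ b) = some 0),
    ∃ h' : strands 0 (a ++ r ++ b) = some 0,
      Diagram.link ⟨a ++ l ++ b, h⟩ = Diagram.link ⟨a ++ r ++ b, h'⟩

namespace Isotopic

theorem refl (l : List Slice) : Isotopic l l := fun _ _ h => ⟨h, rfl⟩

theorem trans {l m r : List Slice} (h₁ : Isotopic l m) (h₂ : Isotopic m r) : Isotopic l r := by
  intro a b h
  obtain ⟨h', e⟩ := h₁ a b h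
  obtain ⟨h'', e'⟩ := h₂ a b h'
  exact ⟨h'', e.trans e'⟩

theorem append {l r : List Slice} (h : Isotopic l r) (c d : List Slice) :
    Isotopic (c ++ l ++ d) (c ++ r ++ d) := by
  intro a b
  have := h (a ++ c) (d ++ b)
  simpa only [List.append_assoc] using this

theorem append_right {l r : List Slice} (h : Isotopic l r) (d : List Slice) :
    Isotopic (l ++ d) (r ++ d) :=
  h.append [] d

theorem cons {l r : List Slice} (h : Isotopic l r) (s : Slice) : Isotopic (s :: l) (s :: r) := by
  simpa using h.append [s] []

end Isotopic

theorem strands_append (v w : List Slice) (n : ℕ) :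
    strands n (v ++ w) = (strands n v).bind fun m => strands m w := by
  induction v generalizing n with
  | nil => rfl
  | cons s v ih =>
    simp only [List.cons_append, strands]
    split_ifs
    · exact ih _
    · rfl

/-- Wherever the stack `l` fits, the stack `r` fits as well, with the same number of strands
above it. -/
def Fits (l r : List Slice) : Prop := ∀ n m, strands n l = some m → strands n r = some m

theorem Fits.closed {l r : List Slice} (h : Fits l r) {a b : List Slice}
    (hl : strands 0 (a ++ l ++ b) = some 0) : strands 0 (a ++ r ++ b) = some 0 := by
  simp only [strands_append, Option.bind_eq_some_iff] at hl ⊢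
  obtain ⟨m, ⟨k, hk, hm⟩, hb⟩ := hl
  exact ⟨m, ⟨k, hk, h k m hm⟩, hb⟩

theorem LocalMove.isotopic {l r : List Slice} (h : LocalMove l r) (hf : Fits l r) :
    Isotopic l r :=
  fun a b _ => ⟨hf.closed ‹_›, Quot.sound ⟨a, l, r, b, h, rfl, rfl⟩⟩

/-- `Fits` is not symmetric: undoing a move can require strands that the simpler stack does not
mention. -/
theorem LocalMove.isotopic_symm {l r : List Slice} (h : LocalMove l r) (hf : Fits r l) :
    Isotopic r l :=
  fun a b _ => ⟨hf.closed ‹_›, Eq.symm (Quot.sound ⟨a, l, r, b, h, rfl, rfl⟩)⟩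

/-- The inequality keeps the natural subtraction from truncating, and is the test that
`simplifyHead` performs. -/
theorem isotopic_exchange (g h : Piece) {i j : ℕ} (hij : i + g.out ≤ j) :
    Isotopic [⟨g, i⟩, ⟨h, j⟩] [⟨h, j - g.out + g.inn⟩, ⟨g, i⟩] := by
  obtain ⟨k, rfl⟩ := Nat.exists_eq_add_of_le hij
  have e : i + g.out + k - g.out + g.inn = i + g.inn + k := by omega
  rw [e]
  refine (LocalMove.exchange g h i k).isotopic fun n m => ?_
  simp only [strands]
  grind

theorem isotopic_exchange_symm (g h : Piece) {i j : ℕ} (hij : i + g.inn ≤ j) :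
    Isotopic [⟨h, j⟩, ⟨g, i⟩] [⟨g, i⟩, ⟨h, j - g.inn + g.out⟩] := by
  obtain ⟨k, rfl⟩ := Nat.exists_eq_add_of_le hij
  have e : i + g.inn + k - g.inn + g.out = i + g.out + k := by omega
  rw [e]
  refine (LocalMove.exchange g h i k).isotopic_symm fun n m => ?_
  simp only [strands]
  grind

theorem isotopic_zigzag {i j : ℕ} (h : i = j + 1 ∨ j = i + 1) : Isotopic [cup i, cap j] [] := by
  rcases h with rfl | rfl
  · refine (LocalMove.zigzag_right j).isotopic fun n m => ?_
    simp only [strands, Piece.inn, Piece.out]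
    grind
  · refine (LocalMove.zigzag_left i).isotopic fun n m => ?_
    simp only [strands, Piece.inn, Piece.out]
    grind

theorem isotopic_swing_cup (e : Bool) {i j : ℕ} (h : i = j + 1 ∨ j = i + 1) :
    Isotopic [cup i, cross e j] [cup j, cross (!e) i] := by
  rcases h with rfl | rfl
  · have := LocalMove.swing_cup (!e) j
    rw [Bool.not_not] at this
    refine this.isotopic_symm fun n m => ?_
    simp only [strands, Piece.inn, Piece.out]
    grind
  · refine (LocalMove.swing_cup e i).isotopic fun n m => ?_
    simp only [strands, Piece.inn, Piece.out]
    grind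

theorem isotopic_swing_cap (e : Bool) {i j : ℕ} (h : i = j + 1 ∨ j = i + 1) :
    Isotopic [cross e i, cap j] [cross (!e) j, cap i] := by
  rcases h with rfl | rfl
  · refine (LocalMove.swing_cap e j).isotopic fun n m => ?_
    simp only [strands, Piece.inn, Piece.out]
    grind
  · have := LocalMove.swing_cap (!e) i
    rw [Bool.not_not] at this
    refine this.isotopic_symm fun n m => ?_
    simp only [strands, Piece.inn, Piece.out]
    grind

theorem isotopic_reidemeister1_cup (e : Bool) (i : ℕ) : Isotopic [cup i, cross e i] [cup i] := by
  refine (LocalMove.reidemeister1_cup e i).isotopic fun n m => ?_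
  simp only [strands, Piece.inn, Piece.out]
  grind

theorem isotopic_reidemeister1_cap (e : Bool) (i : ℕ) : Isotopic [cross e i, cap i] [cap i] := by
  refine (LocalMove.reidemeister1_cap e i).isotopic fun n m => ?_
  simp only [strands, Piece.inn, Piece.out]
  grind

theorem isotopic_reidemeister2 (e : Bool) (i : ℕ) : Isotopic [cross e i, cross (!e) i] [] := by
  refine (LocalMove.reidemeister2 e i).isotopic fun n m => ?_
  simp only [strands, Piece.inn, Piece.out]
  grind

theorem isotopic_reidemeister3_same (e : Bool) {i j : ℕ} (h : i = j + 1 ∨ j = i + 1) :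
    Isotopic [cross e i, cross e j, cross e i] [cross e j, cross e i, cross e j] := by
  rcases h with rfl | rfl
  · refine (LocalMove.reidemeister3 e j).isotopic_symm fun n m => ?_
    simp only [strands, Piece.inn, Piece.out]
    grind
  · refine (LocalMove.reidemeister3 e i).isotopic fun n m => ?_
    simp only [strands, Piece.inn, Piece.out]
    grind

/-- Creating two cancelling crossings in front of a stack that needs the strands they cross. -/
theorem isotopic_create_left {w : List Slice} {e : Bool} {i : ℕ}
    (hw : Fits w ([cross e i, cross (!e) i] ++ w)) :
    Isotopic w ([cross e i, cross (!e) i] ++ w) := by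
  intro a b h
  refine ⟨hw.closed h, Eq.symm (Quot.sound
    ⟨a, _, _, w ++ b, LocalMove.reidemeister2 e i, ?_, ?_⟩)⟩ <;> simp

theorem isotopic_create_right {w : List Slice} {e : Bool} {i : ℕ}
    (hw : Fits w (w ++ [cross e i, cross (!e) i])) :
    Isotopic w (w ++ [cross e i, cross (!e) i]) := by
  intro a b h
  refine ⟨hw.closed h, Eq.symm (Quot.sound
    ⟨a ++ w, _, _, b, LocalMove.reidemeister2 e i, ?_, ?_⟩)⟩ <;> simp

/-- The third Reidemeister move for all the ways to stack the three strands. -/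
theorem isotopic_reidemeister3 {e e' e'' : Bool} (he : e = e' ∨ e' = e'') {i j : ℕ}
    (h : i = j + 1 ∨ j = i + 1) :
    Isotopic [cross e i, cross e' j, cross e'' i] [cross e'' j, cross e' i, cross e j] := by
  by_cases hs : e = e''
  · obtain rfl : e = e' := by grind
    subst hs
    exact isotopic_reidemeister3_same e h
  obtain rfl : e'' = !e := by cases e <;> cases e'' <;> simp_all
  rcases he with rfl | rfl
  -- Mixed signs reduce to equal signs: insert a cancelling pair at `j`, apply the equal-sign move,
  -- and cancel the pair that appears at `i`.
  · have h₁ : Isotopic [cross e i, cross e j, cross (!e) i]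
        ([cross (!e) j, cross (!!e) j] ++ [cross e i, cross e j, cross (!e) i]) := by
      refine isotopic_create_left fun n m => ?_
      simp only [strands, List.cons_append, List.nil_append, Piece.inn, Piece.out]
      grind
    rw [Bool.not_not] at h₁
    have h₂ := (isotopic_reidemeister3_same e h.symm).append [cross (!e) j] [cross (!e) i]
    have h₃ := (isotopic_reidemeister2 e i).append [cross (!e) j, cross e i, cross e j] []
    exact h₁.trans (h₂.trans h₃)
  · have h₁ : Isotopic [cross e i, cross (!e) j, cross (!e) i]
        ([cross e i, cross (!e) j, cross (!e) i] ++ [cross (!e) j, cross (!!e) j]) := by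
      refine isotopic_create_right fun n m => ?_
      simp only [strands, List.cons_append, List.nil_append, Piece.inn, Piece.out]
      grind
    rw [Bool.not_not] at h₁
    have h₂ := (isotopic_reidemeister3_same (!e) h.symm).append [cross e i] [cross e j]
    have h₃ := (isotopic_reidemeister2 e i).append [] [cross (!e) j, cross (!e) i, cross e j]
    exact h₁.trans (h₂.trans h₃)

/-! ### A verified simplification procedure -/

/-- Apply a move that does not create crossings or extrema to the first slices of a stack. -/
def simplifyHead : List Slice → Option (List Slice)
  | ⟨g, i⟩ :: ⟨h, j⟩ :: w =>
    if i + g.out ≤ j then some ([⟨h, j - g.out + g.inn⟩, ⟨g, i⟩] ++ w)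
    else if j + h.inn ≤ i then some ([⟨h, j⟩, ⟨g, i - h.inn + h.out⟩] ++ w)
    else match g, h with
      | .cup, .cap => if i = j + 1 ∨ j = i + 1 then some w else none
      | .cup, .cross e =>
        if i = j then some (cup i :: w)
        else if i = j + 1 ∨ j = i + 1 then some ([cup j, cross (!e) i] ++ w) else none
      | .cross e, .cap =>
        if i = j then some (cap i :: w)
        else if i = j + 1 ∨ j = i + 1 then some ([cross (!e) j, cap i] ++ w) else none
      | .cross e, .cross e' =>
        if i = j then if e' = !e then some w else none
        else if i = j + 1 ∨ j = i + 1 then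
          match w with
          | ⟨.cross e'', k⟩ :: w =>
            -- Excluded are the triples whose middle sign differs from both others; they are no
            -- third Reidemeister move.
            if k = i ∧ (e = e' ∨ e' = e'') then
              some ([cross e'' j, cross e' i, cross e j] ++ w)
            else none
          | _ => none
        else none
      | _, _ => none
  | _ => none

theorem isotopic_simplifyHead {w w' : List Slice} (h : simplifyHead w = some w') :
    Isotopic w w' := by
  unfold simplifyHead at h
  split at h
  next g i h' j w =>
    split at h
    · obtain rfl := Option.some.inj h
      exact (isotopic_exchange g h' ‹_›).append_right w
    split at h
    · obtain rfl := Option.some.inj h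
      exact (isotopic_exchange_symm h' g ‹_›).append_right w
    · split at h
      · split_ifs at h with h₃
        obtain rfl := Option.some.inj h
        exact (isotopic_zigzag h₃).append_right w
      · split_ifs at h with h₃ h₃
        · obtain rfl := Option.some.inj h
          subst h₃
          exact (isotopic_reidemeister1_cup _ i).append_right w
        · obtain rfl := Option.some.inj h
          exact (isotopic_swing_cup _ h₃).append_right w
      · split_ifs at h with h₃ h₃
        · obtain rfl := Option.some.inj h
          subst h₃
          exact (isotopic_reidemeister1_cap _ i).append_right w
        · obtain rfl := Option.some.inj h
          exact (isotopic_swing_cap _ h₃).append_right w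
      · split_ifs at h with h₃ h₄ h₃'
        · obtain rfl := Option.some.inj h
          subst h₃ h₄
          exact (isotopic_reidemeister2 _ i).append_right w
        · split at h
          · split_ifs at h with h₄
            obtain rfl := Option.some.inj h
            obtain ⟨rfl, h₄⟩ := h₄
            exact (isotopic_reidemeister3 h₄ h₃').append_right _
          · cases h
      · cases h
  next => cases h

/-- Apply a move that does not create crossings or extrema above the first `k` slices. -/
def simplifyAt : ℕ → List Slice → Option (List Slice)
  | 0, w => simplifyHead w
  | _ + 1, [] => none
  | k + 1, s :: w => (simplifyAt k w).map (s :: ·)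

theorem isotopic_simplifyAt {k : ℕ} {w w' : List Slice} (h : simplifyAt k w = some w') :
    Isotopic w w' := by
  induction k generalizing w w' with
  | zero => exact isotopic_simplifyHead h
  | succ k ih =>
    cases w with
    | nil => cases h
    | cons s w =>
      obtain ⟨v, hv, rfl⟩ := Option.map_eq_some_iff.mp h
      exact (ih hv).cons s

/-- Apply a sequence of moves at the given heights. -/
def simplify : List ℕ → List Slice → Option (List Slice)
  | [], w => some w
  | k :: ks, w => (simplifyAt k w).bind (simplify ks)

theorem isotopic_simplify {ks : List ℕ} {w w' : List Slice} (h : simplify ks w = some w') :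
    Isotopic w w' := by
  induction ks generalizing w with
  | nil => exact Option.some.inj h ▸ Isotopic.refl w
  | cons k ks ih =>
    obtain ⟨v, hv, h⟩ := Option.bind_eq_some_iff.mp h
    exact (isotopic_simplifyAt hv).trans (ih h)

/-- Equality of links becomes a computation with words, which the kernel can decide. -/
theorem Diagram.link_eq_of_simplify {D D' : Diagram} (ks : List ℕ)
    (h : simplify ks D.word = some D'.word) : D.link = D'.link := by
  obtain ⟨w, hw⟩ := D
  obtain ⟨w', hw'⟩ := D'
  obtain ⟨h', e⟩ := isotopic_simplify h [] [] (by simpa using hw)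
  simpa using e

/-- If a diagram of `L` simplifies to the unknot after the smoothing of two neighbouring strands,
then `L` can be unknotted by one H(2)-move. -/
theorem unknotsIn_one_of_simplify {D : Diagram} (a b : List Slice) (i : ℕ) (ks ls : List ℕ)
    (hc : strands 0 (a ++ b) = some 0) (hc' : strands 0 (a ++ [cap i, cup i] ++ b) = some 0)
    (hk : simplify ks (a ++ b) = some D.word)
    (hl : simplify ls (a ++ [cap i, cup i] ++ b) = some [cup 0, cap 0]) :
    D.link.UnknotsIn 1 :=
  ⟨unknot, ⟨⟨a ++ b, hc⟩, ⟨a ++ [cap i, cup i] ++ b, hc'⟩, Diagram.link_eq_of_simplify ks hk,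
    Diagram.link_eq_of_simplify ls hl, Or.inl ⟨a, b, i, rfl, rfl⟩⟩, rfl⟩

/-! ### Mirror images -/

theorem Slice.mirror_mirror (s : Slice) : s.mirror.mirror = s := by
  obtain ⟨_ | _ | e, i⟩ := s <;> simp [Slice.mirror, Piece.mirror]

theorem Diagram.mirror_mirror (D : Diagram) : D.mirror.mirror = D := by
  obtain ⟨w, hw⟩ := D
  simp [Diagram.mirror, Function.comp_def, Slice.mirror_mirror]

theorem Piece.inn_mirror (g : Piece) : g.mirror.inn = g.inn := by cases g <;> rfl

theorem Piece.out_mirror (g : Piece) : g.mirror.out = g.out := by cases g <;> rfl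

theorem LocalMove.mirror {l r : List Slice} (h : LocalMove l r) :
    LocalMove (l.map Slice.mirror) (r.map Slice.mirror) := by
  cases h with
  | exchange g h i k =>
    have := LocalMove.exchange g.mirror h.mirror i k
    rwa [Piece.inn_mirror, Piece.out_mirror] at this
  | zigzag_left i => exact .zigzag_left i
  | zigzag_right i => exact .zigzag_right i
  | swing_cup e i => exact .swing_cup (!e) i
  | swing_cap e i => exact .swing_cap (!e) i
  | reidemeister1_cup e i => exact .reidemeister1_cup (!e) i
  | reidemeister1_cap e i => exact .reidemeister1_cap (!e) i
  | reidemeister2 e i => exact .reidemeister2 (!e) i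
  | reidemeister3 e i => exact .reidemeister3 (!e) i

/-- The mirror image of a link. -/
def Link.mirror : Link → Link :=
  Quot.map Diagram.mirror (by
    rintro D D' ⟨a, l, r, b, h, hD, hD'⟩
    exact ⟨a.map Slice.mirror, _, _, b.map Slice.mirror, h.mirror,
      by simp [Diagram.mirror, hD], by simp [Diagram.mirror, hD']⟩)

theorem Link.mirror_mirror (L : Link) : L.mirror.mirror = L := by
  induction L using Quot.ind with
  | mk D => exact congrArg Diagram.link D.mirror_mirror

theorem Diagram.Smoothing.mirror {D D' : Diagram} (h : D.Smoothing D') :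
    D.mirror.Smoothing D'.mirror := by
  obtain ⟨a, b, i, hD, hD'⟩ := h
  exact ⟨a.map Slice.mirror, b.map Slice.mirror, i, by simp [Diagram.mirror, hD],
    by simp [Diagram.mirror, hD', Slice.mirror, Piece.mirror]⟩

theorem Link.H2Move.mirror {L L' : Link} (h : L.H2Move L') : L.mirror.H2Move L'.mirror := by
  obtain ⟨D, D', rfl, rfl, h⟩ := h
  exact ⟨D.mirror, D'.mirror, rfl, rfl, h.imp Diagram.Smoothing.mirror Diagram.Smoothing.mirror⟩

theorem Link.UnknotsIn.mirror {k : ℕ} {L : Link} (h : L.UnknotsIn k) : L.mirror.UnknotsIn k := by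
  induction k generalizing L with
  | zero =>
    obtain rfl : L = unknot := h
    -- The circle has no crossings to switch.
    rfl
  | succ k ih =>
    obtain ⟨L', h, h'⟩ := h
    exact ⟨L'.mirror, h.mirror, ih h'⟩

/-- Mirroring is an involution, so preserving unknotting sequences in one direction suffices. -/
theorem Link.u₂_mirror (L : Link) : L.mirror.u₂ = L.u₂ := by
  have key (k : ℕ) : L.mirror.UnknotsIn k ↔ L.UnknotsIn k :=
    ⟨fun h => L.mirror_mirror ▸ h.mirror, fun h => h.mirror⟩
  simp only [Link.u₂, key]

theorem Link.u₂_eq_one {L : Link} (h : L ≠ unknot) (h' : L.UnknotsIn 1) : L.u₂ = 1 := by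
  refine le_antisymm (iInf₂_le_of_le 1 h' le_rfl) (le_iInf₂ fun k hk => ?_)
  cases k with
  | zero => exact absurd hk h
  | succ k => simp

/-! ### Unknotting by one smoothing -/

/-- The diagram, cut at the height of the smoothing, is the Conway form with an extra minimum,
maximum and pair of crossings, which bring two suitable arcs side by side. The first move list
removes the detour; the second unknots the smoothed diagram. The other three certificates have the
same form, with four extra crossings for `knot9_26`. -/
theorem knot9_21_unknotsIn_one : knot9_21.link.UnknotsIn 1 := by
  refine unknotsIn_one_of_simplify
    [cup 0, cup 2, cross true 1, cup 2, cross true 3, cross true 3, cross true 2, cross true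
      1, cross false 0]
    [cap 2, cross true 1, cross false 0, cross false 0, cross true 1, cross true 1, cap 0, cap
      0]
    1
    [8, 7, 6, 5, 4, 3]
    [10, 3, 4, 3, 5, 6, 7, 8, 2, 3, 6, 4, 6, 7, 0, 1, 2, 3, 4, 5, 4, 3, 1, 2, 1, 2, 1]
    ?_ ?_ ?_ ?_ <;> decide +kernel

theorem knot9_23_unknotsIn_one : knot9_23.link.UnknotsIn 1 := by
  refine unknotsIn_one_of_simplify
    [cup 0, cup 2, cross true 1, cross true 1, cross false 0, cross false 0, cup 2, cross true
      1, cross false 2, cross false 3, cross false 0]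
    [cap 2, cross false 0, cross true 1, cross true 1, cap 0, cap 0]
    1
    [10, 9, 8, 7, 6]
    [12, 9, 10, 11, 12, 14, 6, 9, 10, 8, 7, 6, 1, 13, 12, 11, 10, 9, 8, 7, 6, 5, 4, 2, 1, 1,
      0, 1, 2, 1, 1, 0, 1, 10, 11, 10, 9, 8, 7, 6, 5, 4, 2, 1, 1, 0, 1, 2, 1, 3, 8, 7, 6, 5,
      4, 3, 1, 2, 1, 2, 1]
    ?_ ?_ ?_ ?_ <;> decide +kernel

theorem knot9_26_unknotsIn_one : knot9_26.link.UnknotsIn 1 := by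
  refine unknotsIn_one_of_simplify
    [cup 0, cup 2, cross true 1, cross true 1, cross true 1, cup 1, cross false 2, cross true
      3, cross false 2, cross false 1, cross false 0, cross true 3, cross false 0, cross false
      1, cross false 2, cross false 2]
    [cap 0, cap 1, cap 0]
    1
    [15, 14, 13, 12, 11, 10, 9, 8, 7, 6, 5]
    [17, 15, 13, 15, 11, 14, 15, 14, 12, 14, 5, 6, 7, 9, 10, 11, 5, 4, 11, 10, 9, 7, 5, 7, 10,
      9, 7, 9, 4, 5, 6, 7, 8, 9, 8, 7, 6, 5, 4, 3, 2, 4, 0, 1, 1, 2, 1]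
    ?_ ?_ ?_ ?_ <;> decide +kernel

theorem knot9_31_unknotsIn_one : knot9_31.link.UnknotsIn 1 := by
  refine unknotsIn_one_of_simplify
    [cup 0, cup 2, cross true 1, cross true 1, cross false 0, cup 2, cross true 1, cross false
      0, cross true 1, cross false 0, cross true 1, cross true 2, cross true 3]
    [cap 2, cross true 1, cap 0, cap 0]
    3
    [12, 11, 10, 9, 8, 7, 6, 5]
    [12, 13, 5, 6, 12, 10, 9, 7, 9, 8, 6, 5, 10, 11, 12, 1, 10, 12, 11, 10, 9, 8, 7, 6, 5, 4,
      2, 1, 1, 0, 1, 2, 1, 3, 4, 5, 8, 7, 6, 3, 2, 5, 3, 5, 1, 2, 3, 4, 5, 3, 0, 1, 2, 1]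
    ?_ ?_ ?_ ?_ <;> decide +kernel

end KnotDiagram

/-- The knots `9₂₁`, `9₂₃`, `9₂₆`, `9₃₁`, in either chirality, have H(2)-unknotting number one. -/
theorem corollary1p2 :
    ∀ D ∈ [KnotDiagram.knot9_21, KnotDiagram.knot9_23, KnotDiagram.knot9_26,
        KnotDiagram.knot9_31],
      D.link.u₂ = 1 ∧ D.mirror.link.u₂ = 1 := by
  have key {D : KnotDiagram.Diagram} (h : D.link ≠ KnotDiagram.unknot)
      (h' : D.link.UnknotsIn 1) : D.link.u₂ = 1 ∧ D.mirror.link.u₂ = 1 :=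
    ⟨KnotDiagram.Link.u₂_eq_one h h',
      -- `D.mirror.link` is `D.link.mirror` by definition of `Quot.map`.
      (KnotDiagram.Link.u₂_mirror D.link).trans (KnotDiagram.Link.u₂_eq_one h h')⟩
  simp only [List.forall_mem_cons, List.not_mem_nil, false_imp_iff, implies_true, and_true]
  exact ⟨key KnotDiagram.knot9_21_link_ne_unknot KnotDiagram.knot9_21_unknotsIn_one,
    key KnotDiagram.knot9_23_link_ne_unknot KnotDiagram.knot9_23_unknotsIn_one,
    key KnotDiagram.knot9_26_link_ne_unknot KnotDiagram.knot9_26_unknotsIn_one,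
    key KnotDiagram.knot9_31_link_ne_unknot KnotDiagram.knot9_31_unknotsIn_one⟩
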